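/- All graphs are finite, undirected, without loops or parallel edges. Let $G$ be a 4-connected graph (that is, $G$ has more than 4 vertices and $G - S$ is connected for every set $S$ of fewer than 4 vertices) that is claw-free (no induced subgraph of $G$ is isomorphic to $K_{1,3}$). Let $L$ be a 3-vertex path in $G$ (a subgraph of $G$, not necessarily induced), and let $G - L$ denote the graph obtained from $G$ by deleting the three vertices of $L$. Then $G - L$ is connected. If, moreover, the number of vertices of $G$ is divisible by 3, then $G - L$ has a $\Lambda$-factor, that is, a spanning subgraph in which every connected component is a path on 3 vertices. -/

import Mathlib

namespace SimpleGraph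

variable {V W : Type*}

/-- `G` is `k`-connected: it has more than `k` vertices, and it stays connected after the deletion
of any set of fewer than `k` vertices. -/
def IsKConnected (G : SimpleGraph V) (k : ℕ) : Prop :=
  (k : ℕ∞) < ENat.card V ∧ ∀ S : Set V, S.encard < k → (G.induce Sᶜ).Connected

/-- `G` is claw-free: no induced subgraph of `G` is isomorphic to `K_{1,3}`. -/
def IsClawFree (G : SimpleGraph V) : Prop :=
  ¬ (completeBipartiteGraph (Fin 1) (Fin 3)).IsIndContained G

/-- The subgraph `P` of `G` is an `H`-packing: every component of `P` is isomorphic to `H`. -/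
def Subgraph.IsPacking {G : SimpleGraph V} (P : G.Subgraph) (H : SimpleGraph W) : Prop :=
  ∀ c : P.coe.ConnectedComponent, Nonempty (c.toSimpleGraph ≃g H)

/-- The subgraph `P` of `G` is an `H`-factor: an `H`-packing that contains all vertices of `G`. -/
def Subgraph.IsPackingFactor {G : SimpleGraph V} (P : G.Subgraph) (H : SimpleGraph W) : Prop :=
  P.IsPacking H ∧ P.IsSpanning

/-- `G` has a `Λ`-factor, where `Λ` is the 3-vertex path. -/
def HasLambdaFactor (G : SimpleGraph V) : Prop :=
  ∃ P : G.Subgraph, P.IsPackingFactor (pathGraph 3)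

/-- The subgraph `L` of `G` is a (not necessarily induced) 3-vertex path. -/
def Subgraph.IsThreeVertexPath {G : SimpleGraph V} (L : G.Subgraph) : Prop :=
  Nonempty (L.coe ≃g pathGraph 3)

end SimpleGraph

/-! Connectivity of `G - L` is 4-connectedness applied to the three vertices of `L`. For the factor,
fix `x` in `L` and let `H` be the complement of `L`. A nonempty part of `H` without neighbours of
`x` has two outer neighbours in `H`; otherwise the other two vertices of `L` and at most one more
would separate it from `x`. Claw-freeness lets two neighbours of `x` take over the role of the whole
neighbourhood (`exists_linked_of_guarded_neighbors`, based on `Guarded.exists_of_clique`), so `H` is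
linked. On at least three vertices, being linked from `s` to `t` means being connected and becoming
2-connected once `s` and `t` are joined: a chain of blocks with `s` and `t` at opposite ends.

The core is `Linked.hasLambdaPartition`, by induction on size: the set is cut into two smaller
linked sets whose sizes are divisible by 3. Linked sets concatenate along edges (`Linked.append`),
and the sides of a cut vertex are linked up to a neighbour of it (`IsSplit.exists_linked_left`), so
single vertices can be moved between pieces to correct residues. Without a cut vertex, one or two
deletions either produce a cut vertex or let a path be peeled off. With a cut vertex, only sides of
residue 1 resist; a smallest side then gives up one vertex, unless it is a single pendant vertex,
the delicate case of `hasLambdaPartition_of_pendant`. -/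

namespace SimpleGraph

/-! ### Guards, linked sets and cut vertices -/

variable {V : Type*}

/-- A finite vertex set is cut-connected if no proper nonempty part of it is closed under
adjacency inside the set. -/
def CutConnected (G : SimpleGraph V) (S : Finset V) : Prop :=
  ∀ X ⊆ S, X.Nonempty → (∀ a ∈ X, ∀ b ∈ S, G.Adj a b → b ∈ X) → X = S

/-- A cut-connected set `S` is guarded by `T` if every nonempty part of `S` that avoids `T` has at
least two outer neighbours in `S`. -/
def Guarded (G : SimpleGraph V) (S : Finset V) (T : Set V) : Prop :=
  G.CutConnected S ∧ ∀ X ⊆ S, X.Nonempty → (∀ a ∈ X, a ∉ T) → ∀ v,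
    ¬ ∀ a ∈ X, ∀ b ∈ S, G.Adj a b → b ∈ X ∨ b = v

/-- `S` is linked from `s` to `t`: it is guarded by these two of its vertices. -/
def Linked (G : SimpleGraph V) (S : Finset V) (s t : V) : Prop :=
  s ∈ S ∧ t ∈ S ∧ G.Guarded S {s, t}

/-- The vertex `c` separates `S` into the nonempty sides `A` and `B`. -/
structure IsSplit (G : SimpleGraph V) (S : Finset V) (c : V) (A B : Finset V) : Prop where
  mem_iff : ∀ x, x ∈ S ↔ x = c ∨ x ∈ A ∨ x ∈ B
  notMem_left : c ∉ A
  notMem_right : c ∉ B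
  disj : ∀ x ∈ A, x ∉ B
  nonempty_left : A.Nonempty
  nonempty_right : B.Nonempty
  not_adj : ∀ a ∈ A, ∀ b ∈ B, ¬ G.Adj a b

/-- The set `S` has no cut vertex. -/
def NoCut (G : SimpleGraph V) (S : Finset V) : Prop :=
  ∀ c A B, ¬ G.IsSplit S c A B

/-- Three pairwise distinct neighbours of a vertex are not pairwise nonadjacent. -/
def LocallyTwo (G : SimpleGraph V) : Prop :=
  ∀ z a b c, G.Adj z a → G.Adj z b → G.Adj z c → a ≠ b → a ≠ c → b ≠ c →
    G.Adj a b ∨ G.Adj a c ∨ G.Adj b c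

variable {G : SimpleGraph V} {S S' A B H : Finset V} {c s t s' t' x y z : V}

lemma IsClawFree.locallyTwo (h : G.IsClawFree) : G.LocallyTwo := by
  intro z a b c hza hzb hzc hab hac hbc
  by_contra! hn
  obtain ⟨h1, h2, h3⟩ := hn
  let f : Fin 1 ⊕ Fin 3 → V := Sum.elim (fun _ => z) ![a, b, c]
  have hf : Function.Injective f := by
    rintro (i | i) (j | j) hij
    · simp [Subsingleton.elim i j]
    · fin_cases j <;> simp_all [f]
    · fin_cases i <;> simp_all [f]
    · fin_cases i <;> fin_cases j <;> simp_all [f]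
  refine h ⟨⟨⟨f, hf⟩, ?_⟩⟩
  intro p q
  change G.Adj (f p) (f q) ↔ _
  rcases p with i | i <;> rcases q with j | j
  · simp [f]
  · fin_cases j <;> simp [f, hza, hzb, hzc]
  · fin_cases i <;> simp [f, hza.symm, hzb.symm, hzc.symm]
  · fin_cases i <;> fin_cases j <;> simp [f, h1, h2, h3, G.adj_comm b a, G.adj_comm c]

lemma IsSplit.symm (h : G.IsSplit S c A B) : G.IsSplit S c B A := by
  obtain ⟨h1, h2, h3, h4, h5, h6, h7⟩ := h
  exact ⟨by grind, h3, h2, by grind, h6, h5, fun a ha b hb hab => h7 b hb a ha hab.symm⟩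

lemma IsSplit.card_eq (h : G.IsSplit S c A B) : S.card = A.card + B.card + 1 := by
  classical
  obtain ⟨h1, h2, h3, h4, h5, h6, h7⟩ := h
  have : S = insert c (A ∪ B) := by ext; simp [h1]
  rw [this, Finset.card_insert_of_notMem (by simp [h2, h3]),
    Finset.card_union_of_disjoint (Finset.disjoint_left.2 h4)]

/-- If a proper nonempty part of a set without a cut vertex had a single outer neighbour, its
complement would consist of that neighbour alone. -/
lemma NoCut.eq_of_mem (hn : G.NoCut S) {X : Finset V} (hX : X ⊆ S) (hX0 : X.Nonempty) {v : V}
    (hvS : v ∈ S) (hvX : v ∉ X) (h : ∀ a ∈ X, ∀ b ∈ S, G.Adj a b → b ∈ X ∨ b = v) {w : V}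
    (hw : w ∈ S) (hwX : w ∉ X) : w = v := by
  classical
  by_contra hwv
  refine hn v X ((S \ X).erase v) ⟨by grind, hvX, by simp, by grind, hX0, ⟨w, by grind⟩, ?_⟩
  intro a ha b hb hab
  have := h a ha b (by grind) hab
  grind

/-- A part with one outer neighbour leaves only that neighbour outside, but both `s` and `t` lie
outside. -/
lemma NoCut.guarded (hn : G.NoCut S) (hc : G.CutConnected S) {T : Set V} (hs : s ∈ S)
    (ht : t ∈ S) (hst : s ≠ t) (hsT : s ∈ T) (htT : t ∈ T) : G.Guarded S T := by
  refine ⟨hc, fun X hX hX0 hXT v h => ?_⟩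
  have h1 : s ∉ X := fun h => hXT s h hsT
  have h2 : t ∉ X := fun h => hXT t h htT
  by_cases hv : v ∈ S ∧ v ∉ X
  · exact hst ((hn.eq_of_mem hX hX0 hv.1 hv.2 h hs h1).trans
      (hn.eq_of_mem hX hX0 hv.1 hv.2 h ht h2).symm)
  · have := hc X hX hX0 (by grind)
    grind

lemma Guarded.of_inter {T T' : Set V} (h : G.Guarded S T) (hT : ∀ x ∈ S, x ∈ T → x ∈ T') :
    G.Guarded S T' :=
  ⟨h.1, fun X hX hX0 hXT => h.2 X hX hX0 fun a ha haT => hXT a ha (hT a (hX ha) haT)⟩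

/-- A clique among the guards can be replaced by one of its vertices. -/
lemma Guarded.exists_of_clique {T K : Set V} (h : G.Guarded S (T ∪ K)) (hK : G.IsClique K)
    (hK0 : ∃ k ∈ K, k ∈ S) (hT : ∃ r ∈ T, r ∈ S) : ∃ k ∈ K, k ∈ S ∧ G.Guarded S (insert k T) := by
  classical
  by_contra! hne
  have key : ∀ k ∈ K, k ∈ S → ∃ X ⊆ S, X.Nonempty ∧ (∀ a ∈ X, a ∉ T) ∧ k ∉ X ∧
      (∃ l ∈ K, l ∈ X) ∧ ∀ a ∈ X, ∀ b ∈ S, G.Adj a b → b ∈ X ∨ b = k := by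
    intro k hk hkS
    have := hne k hk hkS
    simp only [Guarded, h.1, true_and] at this
    push Not at this
    obtain ⟨X, hX, hX0, hXT, v, hv⟩ := this
    have hkX : k ∉ X := fun hkX => hXT k hkX (by simp)
    have hl : ∃ l ∈ K, l ∈ X := by
      by_contra! hl
      exact h.2 X hX hX0 (fun a ha => by
        rintro (h1 | h1)
        · exact hXT a ha (by simp [h1])
        · exact hl a h1 ha) v hv
    obtain ⟨l, hlK, hlX⟩ := hl
    have hlk : G.Adj l k := hK hlK hk (by rintro rfl; exact hkX hlX)
    have hkv : k = v := (hv l hlX k hkS hlk).resolve_left hkX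
    exact ⟨X, hX, hX0, fun a ha haT => hXT a ha (by simp [haT]), hkX, ⟨l, hlK, hlX⟩, hkv ▸ hv⟩
  obtain ⟨k, hk, hkS⟩ := hK0
  obtain ⟨X, hX, hX0, hXT, hkX, ⟨l, hlK, hlX⟩, hXv⟩ := key k hk hkS
  obtain ⟨Y, hY, hY0, hYT, hlY, ⟨m, hmK, hmY⟩, hYv⟩ := key l hlK (hX hlX)
  have hkY : k ∈ Y := by
    by_cases hmk : m = k
    · exact hmk ▸ hmY
    · rcases hYv m hmY k hkS (hK hmK hk hmk) with h1 | h1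
      · exact h1
      · exact absurd (h1 ▸ hlX) hkX
  -- `X` and `Y` each contain the other's only exit, so their union is closed, yet it misses the
  -- guard `r`.
  obtain ⟨r, hrT, hrS⟩ := hT
  have := h.1 (X ∪ Y) (by grind) ⟨l, by grind⟩ (by clear key hne; grind)
  grind

/-! ### Concatenation of linked sets -/

lemma Linked.symm (h : G.Linked S s t) : G.Linked S t s :=
  ⟨h.2.1, h.1, Set.pair_comm s t ▸ h.2.2⟩

lemma linked_singleton (a : V) : G.Linked {a} a a := by
  refine ⟨by simp, by simp, fun X hX hX0 _ => (Finset.subset_singleton_iff.1 hX).resolve_left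
    hX0.ne_empty, fun X hX hX0 h => ?_⟩
  obtain ⟨b, hb⟩ := hX0
  have := hX hb
  simp only [Finset.mem_singleton] at this
  exact absurd (by simp [this]) (h b hb)

/-- A part whose only exit is in one piece would swallow the other piece, and with it an end, if it
met it. So it stays in one piece; it also avoids the joining end there, whose neighbour across would
be a second exit. -/
lemma Linked.append [DecidableEq V] (h : G.Linked S s t) (h' : G.Linked S' s' t')
    (hd : Disjoint S S') (hadj : G.Adj t s') : G.Linked (S ∪ S') s t' := by
  obtain ⟨hs, ht, hc, hg⟩ := h
  obtain ⟨hs', ht', hc', hg'⟩ := h'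
  have restr : ∀ {P : Finset V}, G.CutConnected P → P ⊆ S ∪ S' → ∀ {X : Finset V},
      (X ∩ P).Nonempty → (∀ a ∈ X, ∀ b ∈ P, G.Adj a b → b ∈ X) → P ⊆ X := by
    intro P hP hPs X hne hcl
    have := hP (X ∩ P) Finset.inter_subset_right hne (by grind)
    exact Finset.inter_eq_right.1 this
  have hdis : ∀ x ∈ S, x ∉ S' := fun _ hx => Finset.disjoint_left.1 hd hx
  refine ⟨by grind, by grind, ?_, ?_⟩
  · intro X hX hX0 hcl
    have e1 : (X ∩ S).Nonempty → S ⊆ X := fun hne =>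
      restr hc Finset.subset_union_left hne (by grind)
    have e2 : (X ∩ S').Nonempty → S' ⊆ X := fun hne =>
      restr hc' Finset.subset_union_right hne (by grind)
    obtain ⟨a, ha⟩ := hX0
    have h1 : t ∈ X ↔ s' ∈ X :=
      ⟨fun h => hcl t h s' (by grind) hadj, fun h => hcl s' h t (by grind) hadj.symm⟩
    have h2 : t ∈ X := by
      rcases Finset.mem_union.1 (hX ha) with h3 | h3
      · exact e1 ⟨a, by grind⟩ ht
      · exact h1.2 (e2 ⟨a, by grind⟩ hs')
    have e3 := e1 ⟨t, by grind⟩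
    have e4 := e2 ⟨s', by grind⟩
    grind
  · intro X hX hX0 hav v hv
    have hsX : s ∉ X := fun h => hav s h (by simp)
    have htX : t' ∉ X := fun h => hav t' h (by simp)
    obtain ⟨a, ha⟩ := hX0
    by_cases hvS : v ∈ S
    · have e : ¬ (X ∩ S').Nonempty := fun hne =>
        htX (restr hc' Finset.subset_union_right hne (by grind) ht')
      have e' : ∀ x ∈ X, x ∉ S' := fun x hx hx' => e ⟨x, by grind⟩
      refine hg X (by grind) ⟨a, ha⟩ ?_ v (by grind)
      rintro b hb (rfl | hbt)
      · exact hsX hb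
      · have hbt : b = t := hbt
        have := hv b hb s' (by grind) (hbt ▸ hadj)
        grind
    · have e : ¬ (X ∩ S).Nonempty := fun hne =>
        hsX (restr hc Finset.subset_union_left hne (by grind) hs)
      have e' : ∀ x ∈ X, x ∉ S := fun x hx hx' => e ⟨x, by grind⟩
      refine hg' X (by grind) ⟨a, ha⟩ ?_ v (by grind)
      rintro b hb (hbs | hbt)
      · have := hv b hb t (by grind) (hbs ▸ hadj.symm)
        grind
      · have hbt : b = t' := hbt
        grind

lemma Linked.cons [DecidableEq V] (h : G.Linked S s t) {a : V} (ha : a ∉ S) (hadj : G.Adj a s) :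
    G.Linked (insert a S) a t := by
  rw [Finset.insert_eq]
  exact (linked_singleton a).append h (by simpa using ha) hadj

lemma Linked.snoc [DecidableEq V] (h : G.Linked S s t) {a : V} (ha : a ∉ S) (hadj : G.Adj t a) :
    G.Linked (insert a S) s a :=
  (h.symm.cons ha hadj.symm).symm

/-! ### Sides of a cut vertex and deletion of a vertex -/

lemma IsSplit.exists_adj_left (h : G.IsSplit S c A B) (hc : G.CutConnected S) :
    ∃ a ∈ A, G.Adj c a := by
  obtain ⟨h1, h2, h3, h4, h5, h6, h7⟩ := h
  by_contra! hne
  have := hc A (by grind) h5 (fun a ha b hb hab => by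
    rcases (h1 b).1 hb with rfl | h | h
    · exact absurd hab.symm (hne a ha)
    · exact h
    · exact absurd hab (h7 a ha b h))
  grind

/-- Two nonadjacent neighbours of `c` in `A` would form a claw with `b`. -/
lemma LocallyTwo.isClique (hG : G.LocallyTwo) {A B : Finset V} {b : V} (hb : b ∈ B)
    (hcb : G.Adj c b) (hd : ∀ x ∈ A, x ∉ B) (hadj : ∀ a ∈ A, ∀ b ∈ B, ¬ G.Adj a b) :
    G.IsClique {a | a ∈ A ∧ G.Adj c a} := by
  rintro a ⟨ha, hca⟩ a' ⟨ha', hca'⟩ hne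
  rcases hG c a a' b hca hca' hcb hne (by grind) (by grind) with h | h | h
  · exact h
  · exact absurd h (hadj a ha b hb)
  · exact absurd h (hadj a' ha' b hb)

/-- A side with a single outer neighbour is linked between its end and a neighbour of that outer
vertex. -/
lemma exists_linked_of_side {M : Finset V} {T : Set V} (hg : G.Guarded M T) (hAM : A ⊆ M)
    (hs : s ∈ A) (hT : ∀ x ∈ A, x ∈ T → x = s) (hcM : c ∈ M) (hcA : c ∉ A)
    (hout : ∀ a ∈ A, ∀ b ∈ M, G.Adj a b → b ∈ A ∨ b = c)
    (hcl : G.IsClique {a | a ∈ A ∧ G.Adj c a}) :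
    ∃ k ∈ A, G.Adj c k ∧ G.Linked A s k := by
  classical
  have hex : ∃ a ∈ A, G.Adj c a := by
    by_contra! hne
    have := hg.1 A hAM ⟨s, hs⟩ (fun a ha b hb hab => (hout a ha b hb hab).resolve_right
      (by rintro rfl; exact hne a ha hab.symm))
    grind
  -- A part closed in `A` can leave only through `c`, so it needs the sole guard `s`. Two
  -- complementary closed parts cannot both contain `s`, whence `A` is connected.
  have hs' : ∀ X ⊆ A, X.Nonempty → (∀ a ∈ X, ∀ b ∈ A, G.Adj a b → b ∈ X) → s ∈ X := by
    intro X hX hX0 hcl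
    by_contra hsX
    exact hg.2 X (by grind) hX0 (by grind) c (by grind)
  have hg' : G.Guarded A ({s} ∪ {a | a ∈ A ∧ G.Adj c a}) := by
    refine ⟨?_, ?_⟩
    · intro X hX hX0 hcl
      by_contra hne
      have h1 := hs' X hX hX0 hcl
      have h2 := hs' (A \ X) (by grind) (by
        rw [Finset.nonempty_iff_ne_empty, Ne, Finset.sdiff_eq_empty_iff_subset]
        exact fun h => hne (hX.antisymm h)) (fun a ha b hb hab => by
          have := hcl b
          have := hab.symm
          grind)
      grind
    · intro X hX hX0 hav v hv
      refine hg.2 X (by grind) hX0 ?_ v ?_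
      · intro a ha haT
        exact hav a ha (Or.inl (hT a (hX ha) haT))
      · intro a ha b hb hab
        rcases hout a (hX ha) b hb hab with h | rfl
        · exact hv a ha b h hab
        · exact absurd (Or.inr ⟨hX ha, hab.symm⟩) (hav a ha)
  obtain ⟨a, ha, hca⟩ := hex
  obtain ⟨k, ⟨hk, hck⟩, -, hk2⟩ := hg'.exists_of_clique hcl ⟨a, ⟨ha, hca⟩, ha⟩ ⟨s, rfl, hs⟩
  exact ⟨k, hk, hck, hs, hk, Set.pair_comm k s ▸ hk2⟩

/-- Each side has no outer neighbour but `c`, so it must contain a guard. -/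
lemma IsSplit.terminals (h : G.IsSplit S c A B) (hl : G.Linked S s t) :
    s ∈ A ∧ t ∈ B ∨ t ∈ A ∧ s ∈ B := by
  have key : ∀ {A B : Finset V}, G.IsSplit S c A B → s ∈ A ∨ t ∈ A := by
    intro A B h
    obtain ⟨h1, h2, h3, h4, h5, h6, h7⟩ := h
    by_contra! hn
    refine hl.2.2.2 A (by grind) h5 (by grind) c ?_
    intro a ha b hb hab
    have := h7 a ha b
    grind
  have h1 := key h
  have h2 := key h.symm
  have := h.disj
  grind

lemma IsSplit.exists_linked_left (h : G.IsSplit S c A B) (hG : G.LocallyTwo)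
    (hl : G.Linked S s t) (hs : s ∈ A) : ∃ k ∈ A, G.Adj c k ∧ G.Linked A s k := by
  obtain ⟨b, hb, hcb⟩ := h.symm.exists_adj_left hl.2.2.1
  have ht := h.terminals hl
  obtain ⟨h1, h2, h3, h4, h5, h6, h7⟩ := h
  refine exists_linked_of_side hl.2.2 (by grind) hs (by grind) (by grind) h2 ?_
    (hG.isClique hb hcb h4 h7)
  intro a ha b hb hab
  have := h7 a ha b
  grind

/-- The guards formed by the neighbourhood of an outer vertex can be reduced to two. -/
lemma exists_linked_of_guarded_neighbors (hG : G.LocallyTwo)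
    (hg : G.Guarded H {y | G.Adj x y}) (hH : 2 ≤ H.card) :
    ∃ y w, G.Adj x y ∧ G.Adj x w ∧ G.Linked H y w := by
  classical
  by_cases hn : G.NoCut H
  · have h1 : ∃ y ∈ H, G.Adj x y := by
      by_contra! hne
      exact hg.2 H subset_rfl (Finset.card_pos.1 (by omega)) hne x (by grind)
    obtain ⟨y, hy, hxy⟩ := h1
    have h2 : ∃ w ∈ H.erase y, G.Adj x w := by
      by_contra! hne
      refine hg.2 (H.erase y) (by grind) (Finset.card_pos.1 ?_) hne y (by grind)
      rw [Finset.card_erase_of_mem hy]; omega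
    obtain ⟨w, hw, hxw⟩ := h2
    exact ⟨y, w, hxy, hxw, hy, by grind, hn.guarded hg.1 hy (by grind : w ∈ H) (by grind)
      (by simp) (by simp)⟩
  · simp only [NoCut, not_forall, not_not] at hn
    obtain ⟨c, A, B, hs⟩ := hn
    have side : ∀ {A B : Finset V}, G.IsSplit H c A B → ∀ X ⊆ A, X.Nonempty →
        (∀ a ∈ X, ∀ b ∈ A, G.Adj a b → b ∈ X) → ∃ a ∈ X, G.Adj x a := by
      intro A B hs X hX hX0 hcl
      obtain ⟨h1, h2, h3, h4, h5, h6, h7⟩ := hs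
      by_contra! hne
      refine hg.2 X (by grind) hX0 hne c ?_
      intro a ha b hb hab
      have := h7 a (hX ha) b
      grind
    obtain ⟨a, ha, hxa⟩ := side hs A subset_rfl hs.nonempty_left (by grind)
    obtain ⟨b, hb, hxb⟩ := side hs.symm B subset_rfl hs.nonempty_right (by grind)
    have hcA := hG.isClique hb hxb hs.disj hs.not_adj
    have hcB := hG.isClique ha hxa hs.symm.disj hs.symm.not_adj
    -- A part containing `c` reaches into both sides, and on the side without its exit `v` it is
    -- closed, so it meets a guard there. Hence `c` itself is not needed as a guard, and the
    -- remaining guards form two cliques.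
    have half : ∀ {A B X : Finset V} {v : V}, G.IsSplit H c A B → c ∈ X →
        (∀ a ∈ X, ∀ b ∈ H, G.Adj a b → b ∈ X ∨ b = v) → v ∉ A → ∃ a ∈ X, a ∈ A ∧ G.Adj x a := by
      intro A B X v hs hcX hv hvA
      obtain ⟨a, ha, hca⟩ := hs.exists_adj_left hg.1
      have hm := hs.mem_iff
      obtain ⟨e, he, hxe⟩ := side hs (X ∩ A) (by grind) ⟨a, by grind⟩ (by grind)
      exact ⟨e, by grind, by grind, hxe⟩
    have hg' : G.Guarded H ({a | a ∈ A ∧ G.Adj x a} ∪ {a | a ∈ B ∧ G.Adj x a}) := by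
      refine ⟨hg.1, fun X hX hX0 hav v hv => ?_⟩
      by_cases hcX : c ∈ X
      · by_cases hvA : v ∈ A
        · obtain ⟨e, he, he'⟩ := half hs.symm hcX hv (hs.disj v hvA)
          exact hav e he (Or.inr he')
        · obtain ⟨e, he, he'⟩ := half hs hcX hv hvA
          exact hav e he (Or.inl he')
      · refine hg.2 X hX hX0 (fun e he hxe => hav e he ?_) v hv
        rcases (hs.mem_iff e).1 (hX he) with rfl | h | h
        · exact absurd he hcX
        · exact Or.inl ⟨h, hxe⟩
        · exact Or.inr ⟨h, hxe⟩
    have hAH : ∀ a ∈ A, a ∈ H := fun a ha => (hs.mem_iff a).2 (Or.inr (Or.inl ha))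
    have hBH : ∀ b ∈ B, b ∈ H := fun a ha => (hs.mem_iff a).2 (Or.inr (Or.inr ha))
    obtain ⟨w, ⟨hw, hxw⟩, -, hw2⟩ :=
      hg'.exists_of_clique hcB ⟨b, ⟨hb, hxb⟩, hBH b hb⟩ ⟨a, ⟨ha, hxa⟩, hAH a ha⟩
    rw [Set.insert_eq] at hw2
    obtain ⟨y, ⟨hy, hxy⟩, -, hy2⟩ :=
      hw2.exists_of_clique hcA ⟨a, ⟨ha, hxa⟩, hAH a ha⟩ ⟨w, rfl, hBH w hw⟩
    exact ⟨y, w, hxy, hxw, hAH y hy, hBH w hw, hy2⟩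

/-- Deleting a vertex from a set without a cut vertex leaves a linked set. -/
lemma NoCut.exists_linked_erase [DecidableEq V] (hn : G.NoCut S) (hc : G.CutConnected S)
    (hG : G.LocallyTwo) (hz : z ∈ S) (hS : 3 ≤ S.card) :
    ∃ y w, G.Adj z y ∧ G.Adj z w ∧ G.Linked (S.erase z) y w := by
  refine exists_linked_of_guarded_neighbors hG ⟨?_, ?_⟩
    (by rw [Finset.card_erase_of_mem hz]; omega)
  · intro X hX hX0 hcl
    by_contra hne
    obtain ⟨w, hw, hwX⟩ : ∃ w ∈ S.erase z, w ∉ X := by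
      by_contra! h
      exact hne (hX.antisymm h)
    have := hn.eq_of_mem (X := X) (v := z) (by grind) hX0 hz (by grind) (by grind) (w := w)
      (by grind) hwX
    grind
  · intro X hX hX0 hav v hv
    -- Since `X` avoids the neighbours of `z`, restoring `z` creates no new exit.
    have hz' : ∀ a ∈ X, ∀ b ∈ S, G.Adj a b → b ∈ X ∨ b = v := by
      intro a ha b hb hab
      by_cases hbz : b = z
      · exact absurd (hbz ▸ hab.symm) (hav a ha)
      · exact hv a ha b (by grind) hab
    by_cases hvX : v ∈ S ∧ v ∉ X
    · have h1 := hn.eq_of_mem (by grind) hX0 hvX.1 hvX.2 hz' hz (by grind)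
      subst h1
      have := hc X (by grind) hX0 (by
        intro a ha b hb hab
        rcases hz' a ha b hb hab with h | rfl
        · exact h
        · exact absurd hab.symm (hav a ha))
      grind
    · have := hc X (by grind) hX0 (by grind)
      grind

/-! ### Partitions into 3-vertex paths: no cut vertex -/

/-- A finite vertex set that can be partitioned into 3-vertex paths. -/
inductive HasLambdaPartition (G : SimpleGraph V) : Finset V → Prop
  | empty : HasLambdaPartition G ∅
  | step {S T : Finset V} {a b c : V} (hS : HasLambdaPartition G S) (hab : G.Adj a b)
      (hbc : G.Adj b c) (hac : a ≠ c) (ha : a ∉ S) (hb : b ∉ S) (hc : c ∉ S)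
      (hT : ∀ x, x ∈ T ↔ x = a ∨ x = b ∨ x = c ∨ x ∈ S) : HasLambdaPartition G T

lemma HasLambdaPartition.union [DecidableEq V] (h : G.HasLambdaPartition S)
    (h' : G.HasLambdaPartition S') (hd : ∀ x ∈ S, x ∉ S') : G.HasLambdaPartition (S ∪ S') := by
  induction h with
  | empty => simpa using h'
  | @step S T a b c hS hab hbc hac ha hb hc hT ih =>
    exact .step (ih (by grind)) hab hbc hac (by grind) (by grind) (by grind) (by grind)

/-- The common end of the inductive steps: both parts are nonempty, hence smaller, and the size of
`Q` is divisible by 3 because those of `S` and `P` are. -/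
lemma hasLambdaPartition_of_two
    (ih : ∀ T p q, T.card < S.card → 3 ∣ T.card → G.Linked T p q → G.HasLambdaPartition T)
    (hS : 3 ∣ S.card) {P Q : Finset V} {p p' q q' : V} (hP : G.Linked P p p')
    (hQ : G.Linked Q q q') (hm : ∀ x, x ∈ S ↔ x ∈ P ∨ x ∈ Q) (hd : ∀ x ∈ P, x ∉ Q)
    (hc : 3 ∣ P.card) : G.HasLambdaPartition S := by
  classical
  have e : S = P ∪ Q := by ext; simp [hm]
  have hcard : S.card = P.card + Q.card := by
    rw [e, Finset.card_union_of_disjoint (Finset.disjoint_left.2 hd)]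
  have h1 : 0 < P.card := Finset.card_pos.2 ⟨p, hP.1⟩
  have h2 : 0 < Q.card := Finset.card_pos.2 ⟨q, hQ.1⟩
  have h3 := ih P p p' (by omega) hc hP
  have h4 := ih Q q q' (by omega) (by omega) hQ
  exact e ▸ h3.union h4 hd

lemma CutConnected.hasLambdaPartition (hc : G.CutConnected S) (hS : S.card = 3) :
    G.HasLambdaPartition S := by
  classical
  obtain ⟨a, b, c, hab, hac, hbc, rfl⟩ := Finset.card_eq_three.1 hS
  have nb : ∀ x ∈ ({a, b, c} : Finset V), ∃ y ∈ ({a, b, c} : Finset V), G.Adj x y := by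
    intro x hx
    by_contra! hne
    have := hc {x} (by simpa using hx) (by simp) (by
      intro a ha b hb hab
      rw [Finset.mem_singleton] at ha
      exact absurd (ha ▸ hab) (hne b hb))
    grind
  have key : G.Adj a b ∧ G.Adj b c ∨ G.Adj b a ∧ G.Adj a c ∨ G.Adj a c ∧ G.Adj c b := by
    have h1 := nb a (by simp)
    have h2 := nb b (by simp)
    have h3 := nb c (by simp)
    simp only [Finset.mem_insert, Finset.mem_singleton, exists_eq_or_imp, exists_eq_left,
      SimpleGraph.irrefl, false_or, or_false] at h1 h2 h3
    have := G.adj_comm a b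
    have := G.adj_comm a c
    have := G.adj_comm b c
    tauto
  rcases key with ⟨h1, h2⟩ | ⟨h1, h2⟩ | ⟨h1, h2⟩
  · exact .step .empty h1 h2 hac (by simp) (by simp) (by simp) (by simp)
  · exact .step .empty h1 h2 hbc (by simp) (by simp) (by simp) (by simp; tauto)
  · exact .step .empty h1 h2 hab (by simp) (by simp) (by simp) (by simp; tauto)

/-- Each side can be extended by `z` at one end and by `c` at the other, which gives the freedom to
correct residues. -/
lemma IsSplit.exists_linked_sides (h : G.IsSplit H c A B) (hG : G.LocallyTwo)
    (hl : G.Linked H y s) (hy : G.Adj z y) (hs : G.Adj z s) :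
    ∃ p k q l, G.Adj z p ∧ G.Linked A p k ∧ G.Adj c k ∧ G.Adj z q ∧ G.Linked B q l ∧ G.Adj c l := by
  rcases h.terminals hl with ⟨h1, h2⟩ | ⟨h1, h2⟩
  · obtain ⟨k, -, hk, hk'⟩ := h.exists_linked_left hG hl h1
    obtain ⟨l, -, hl1, hl2⟩ := h.symm.exists_linked_left hG hl.symm h2
    exact ⟨y, k, s, l, hy, hk', hk, hs, hl2, hl1⟩
  · obtain ⟨k, -, hk, hk'⟩ := h.exists_linked_left hG hl.symm h1
    obtain ⟨l, -, hl1, hl2⟩ := h.symm.exists_linked_left hG hl h2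
    exact ⟨s, k, y, l, hs, hk', hk, hy, hl2, hl1⟩

lemma NoCut.hasLambdaPartition (hn : G.NoCut S) (hc : G.CutConnected S) (hG : G.LocallyTwo)
    (ih : ∀ T p q, T.card < S.card → 3 ∣ T.card → G.Linked T p q → G.HasLambdaPartition T)
    (hS : 3 ∣ S.card) (hS0 : S.Nonempty) : G.HasLambdaPartition S := by
  classical
  have hpos : 0 < S.card := hS0.card_pos
  by_cases h3 : S.card = 3
  · exact hc.hasLambdaPartition h3
  by_cases hcut : ∃ z ∈ S, ¬ G.NoCut (S.erase z)
  · obtain ⟨z, hz, hzc⟩ := hcut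
    simp only [NoCut, not_forall, not_not] at hzc
    obtain ⟨c, A, B, hs⟩ := hzc
    obtain ⟨y, w, hy, hw, hyw⟩ := hn.exists_linked_erase hc hG hz (by omega)
    obtain ⟨p, k, q, l, hp, hA, hk, hq, hB, hl⟩ := hs.exists_linked_sides hG hyw hy hw
    have hcard := hs.card_eq
    rw [Finset.card_erase_of_mem hz] at hcard
    have hm := hs.mem_iff
    have hcA := hs.notMem_left
    have hcB := hs.notMem_right
    have hd := hs.disj
    have hzm := hm z
    obtain ⟨hzc, hzA, hzB⟩ : z ≠ c ∧ z ∉ A ∧ z ∉ B := by grind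
    -- Here the two sides have total size 1 mod 3, and `z` and `c` are distributed accordingly.
    obtain h0 | h0 | h0 : A.card % 3 = 0 ∨ A.card % 3 = 1 ∨ A.card % 3 = 2 := by omega
    · exact hasLambdaPartition_of_two ih hS hA ((hB.snoc hcB hl.symm).cons (a := z) (by grind) hq)
        (by grind) (by grind) (by omega)
    · refine hasLambdaPartition_of_two ih hS
        ((hA.snoc hcA hk.symm).cons (a := z) (by grind) hp) hB (by grind) (by grind) ?_
      rw [Finset.card_insert_of_notMem (by grind), Finset.card_insert_of_notMem hcA]
      omega
    · refine hasLambdaPartition_of_two ih hS (hA.snoc hcA hk.symm) (hB.cons hzB hq)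
        (by grind) (by grind) ?_
      rw [Finset.card_insert_of_notMem hcA]
      omega
  -- Now no single deletion creates a cut vertex, so an edge `uv` is deleted. The rest `H` is linked
  -- both between neighbours of `v` and between neighbours of `u`.
  · push Not at hcut
    obtain ⟨u, hu⟩ := hS0
    obtain ⟨v, w, huv, -, hvw⟩ := hn.exists_linked_erase hc hG hu (by omega)
    obtain ⟨v', w', hvv', -, hvw'⟩ := hn.exists_linked_erase hc hG (Finset.mem_of_mem_erase hvw.1)
      (by omega)
    have hv : v ∈ S.erase u := hvw.1
    have hu' : u ∈ S.erase v := by grind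
    have hcardu := Finset.card_erase_of_mem hu
    have hcardv := Finset.card_erase_of_mem (Finset.mem_of_mem_erase hv)
    obtain ⟨y, w, hy, hw, hyw⟩ := (hcut u hu).exists_linked_erase hvw.2.2.1 hG hv (by omega)
    obtain ⟨y', w', hy', hw', hyw'⟩ :=
      (hcut v (Finset.mem_of_mem_erase hv)).exists_linked_erase hvw'.2.2.1 hG hu' (by omega)
    rw [Finset.erase_right_comm] at hyw'
    by_cases hH : G.NoCut ((S.erase u).erase v)
    · obtain ⟨p, q, -, -, hpq⟩ := hH.exists_linked_erase hyw.2.2.1 hG hyw.1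
        (by rw [Finset.card_erase_of_mem hv]; omega)
      have hyS := hyw.1
      have hP := ((linked_singleton u).cons (a := v) (by grind) huv.symm).cons
        (a := y) (by grind) hy.symm
      refine hasLambdaPartition_of_two ih hS hP hpq (by grind) (by grind) ?_
      rw [Finset.card_insert_of_notMem (by grind), Finset.card_insert_of_notMem (by grind),
        Finset.card_singleton]
    · simp only [NoCut, not_forall, not_not] at hH
      obtain ⟨c, A, B, hs⟩ := hH
      obtain ⟨p, k, q, l, hp, hA, hk, hq, hB, hl⟩ := hs.exists_linked_sides hG hyw hy hw
      obtain ⟨p', k', q', l', hp', hA', hk', hq', hB', hl'⟩ :=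
        hs.exists_linked_sides hG hyw' hy' hw'
      have hcard := hs.card_eq
      rw [Finset.card_erase_of_mem hv] at hcard
      have hm := hs.mem_iff
      have hcA := hs.notMem_left
      have hcB := hs.notMem_right
      have hd := hs.disj
      have hum := hm u
      have hvm := hm v
      obtain ⟨huc, huA, huB⟩ : u ≠ c ∧ u ∉ A ∧ u ∉ B := by grind
      obtain ⟨hvc, hvA, hvB⟩ : v ≠ c ∧ v ∉ A ∧ v ∉ B := by grind
      have huv' : u ≠ v := huv.ne
      -- The sides have total size 0 mod 3. For residue 1, `u` and `v` go to different sides, so `B`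
      -- is entered through its end next to `u`.
      obtain h0 | h0 | h0 : A.card % 3 = 0 ∨ A.card % 3 = 1 ∨ A.card % 3 = 2 := by omega
      · exact hasLambdaPartition_of_two ih hS hA
          (((hB.snoc hcB hl.symm).cons (a := v) (by grind) hq).cons (a := u) (by grind) huv)
          (by grind) (by grind) (by omega)
      · refine hasLambdaPartition_of_two ih hS
          ((hA.snoc hcA hk.symm).cons (a := v) (by grind) hp) (hB'.cons huB hq')
          (by grind) (by grind) ?_
        rw [Finset.card_insert_of_notMem (by grind), Finset.card_insert_of_notMem hcA]
        omega
      · refine hasLambdaPartition_of_two ih hS (hA.snoc hcA hk.symm)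
          ((hB.cons hvB hq).cons (a := u) (by grind) huv) (by grind) (by grind) ?_
        rw [Finset.card_insert_of_notMem hcA]
        omega

/-! ### A pendant vertex -/

/-- Deleting a vertex whose neighbours form a clique from a linked set leaves a linked set. -/
lemma Linked.exists_erase [DecidableEq V] (hl : G.Linked S s t) (hst : s ≠ t) (hc : c ∈ S)
    (hcl : G.IsClique {a | a ∈ S.erase c ∧ G.Adj c a}) : ∃ p q, G.Linked (S.erase c) p q := by
  obtain ⟨hs, ht, hg⟩ := hl
  by_cases hcs : c = s
  · obtain ⟨k, -, -, hk⟩ := exists_linked_of_side (A := S.erase c) hg (by grind)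
      (by grind : t ∈ S.erase c) (by grind) hc (by simp) (by grind) hcl
    exact ⟨t, k, hk⟩
  by_cases hct : c = t
  · obtain ⟨k, -, -, hk⟩ := exists_linked_of_side (A := S.erase c) hg (by grind)
      (by grind : s ∈ S.erase c) (by grind) hc (by simp) (by grind) hcl
    exact ⟨s, k, hk⟩
  have hmem : ∀ X ⊆ S.erase c, X.Nonempty → (∀ a ∈ X, ∀ b ∈ S.erase c, G.Adj a b → b ∈ X) →
      ∃ a ∈ X, G.Adj c a := by
    intro X hX hX0 hcl
    by_contra! hne
    have := hg.1 X (by grind) hX0 (fun a ha b hb hab => by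
      have := hne a ha
      by_cases hbc : b = c
      · exact absurd (hbc ▸ hab.symm) this
      · exact hcl a ha b (by grind) hab)
    grind
  refine ⟨s, t, by grind, by grind, ?_, ?_⟩
  · intro X hX hX0 hX1
    by_contra hne
    obtain ⟨a, ha, hca⟩ := hmem X hX hX0 hX1
    obtain ⟨b, hb, hcb⟩ := hmem (S.erase c \ X) (by grind) (by
        rw [Finset.nonempty_iff_ne_empty, Ne, Finset.sdiff_eq_empty_iff_subset]
        exact fun h => hne (hX.antisymm h)) (fun a ha b hb hab => by
          have := hX1 b
          have := hab.symm
          grind)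
    have hab : a ≠ b := by grind
    have := hX1 a ha b (by grind) (hcl ⟨hX ha, hca⟩ ⟨by grind, hcb⟩ hab)
    grind
  · intro X hX hX0 hav v hv
    -- If `X` touches `c`, the clique condition puts every neighbour of `c` in `X` or at `v`, so
    -- adding `c` to `X` creates no new exit.
    by_cases he : ∃ e ∈ X, G.Adj c e
    · obtain ⟨e, he, hce⟩ := he
      refine hg.2 (insert c X) (by grind) ⟨e, by grind⟩ ?_ v ?_
      · intro a ha hat
        rcases Finset.mem_insert.1 ha with rfl | ha
        · rcases hat with h | h
          · exact hcs h
          · exact hct h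
        · exact hav a ha hat
      · intro a ha b hb hab
        by_cases hbc : b = c
        · grind
        rcases Finset.mem_insert.1 ha with rfl | ha
        · by_cases hbe : b = e
          · grind
          · have := hv e he b (by grind) (hcl ⟨hX he, hce⟩ ⟨by grind, hab⟩ (Ne.symm hbe))
            grind
        · have := hv a ha b (by grind) hab
          grind
    · push Not at he
      refine hg.2 X (by grind) hX0 hav v (fun a ha b hb hab => ?_)
      by_cases hbc : b = c
      · exact absurd (hbc ▸ hab.symm) (he a ha)
      · exact hv a ha b (by grind) hab

/-- The final regrouping: a tail `x, b, z`, a linked set `A` behind it and the rest `M`. -/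
lemma hasLambdaPartition_of_tail_and_two {M : Finset V} {b k w p q : V} [DecidableEq V]
    (ih : ∀ T p q, T.card < S.card → 3 ∣ T.card → G.Linked T p q → G.HasLambdaPartition T)
    (hS : 3 ∣ S.card) (hm : ∀ v, v ∈ S ↔ v = x ∨ v = b ∨ v = z ∨ v ∈ A ∨ v ∈ M)
    (hxb : G.Adj x b) (hbz : G.Adj b z) (hzy : G.Adj z y) (hzw : G.Adj z w) (hby : G.Adj b y)
    (hck : G.Adj c k) (hAl : G.Linked A y k) (hMl : G.Linked M w t)
    (hpq : G.Linked (M.erase c) p q) (hcM : c ∈ M) (hcard : S.card = A.card + M.card + 3)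
    (hxz : x ≠ z) (hxA : x ∉ A) (hbA : b ∉ A) (hzA : z ∉ A) (hbM : b ∉ M ∧ x ∉ M)
    (hzM : z ∉ M) (hAM : ∀ a ∈ A, a ∉ M) : G.HasLambdaPartition S := by
  have hxb' := hxb.ne
  have hbz' := hbz.ne
  have hcA : c ∉ A := fun h => hAM c h hcM
  obtain h0 | h0 | h0 : A.card % 3 = 0 ∨ A.card % 3 = 1 ∨ A.card % 3 = 2 := by omega
  · refine hasLambdaPartition_of_two ih hS (((hAl.cons hzA hzy).cons (a := b) (by grind) hbz).cons
      (a := x) (by grind) hxb) hMl (by grind) (by grind) ?_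
    rw [Finset.card_insert_of_notMem (by grind), Finset.card_insert_of_notMem (by grind),
      Finset.card_insert_of_notMem (by grind)]
    omega
  · refine hasLambdaPartition_of_two ih hS ((hAl.cons hbA hby).cons (a := x) (by grind) hxb)
      (hMl.cons (a := z) (by grind) hzw) (by grind) (by grind) ?_
    rw [Finset.card_insert_of_notMem (by grind), Finset.card_insert_of_notMem (by grind)]
    omega
  · refine hasLambdaPartition_of_two ih hS ((((hAl.snoc hcA hck.symm).cons (a := z) (by grind)
      hzy).cons (a := b) (by grind) hbz).cons (a := x) (by grind) hxb) hpq (by grind) (by grind) ?_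
    rw [Finset.card_insert_of_notMem (by grind), Finset.card_insert_of_notMem (by grind),
      Finset.card_insert_of_notMem (by grind), Finset.card_insert_of_notMem (by grind)]
    omega

set_option maxHeartbeats 1000000 in
/-- The case of a pendant vertex `x` attached at a cut vertex `b`. -/
lemma hasLambdaPartition_of_pendant {b : V} (hG : G.LocallyTwo)
    (ih : ∀ T p q, T.card < S.card → 3 ∣ T.card → G.Linked T p q → G.HasLambdaPartition T)
    (hS : 3 ∣ S.card) (hm : ∀ v, v ∈ S ↔ v = x ∨ v = b ∨ v ∈ B) (hxb : G.Adj x b) (hxB : x ∉ B)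
    (hbB : b ∉ B) (hbz : G.Adj b z) (hl : G.Linked B z t)
    (hcl : G.IsClique {a | a ∈ B ∧ G.Adj b a}) (hB : 2 ≤ B.card) : G.HasLambdaPartition S := by
  classical
  obtain ⟨hz, ht, hg⟩ := hl
  have hxb' := hxb.ne
  have hzx : z ≠ x := by grind
  have hzb : z ≠ b := by grind
  have hcardS : S.card = B.card + 2 := by
    have : S = insert x (insert b B) := by ext; simp [hm]
    rw [this, Finset.card_insert_of_notMem (by grind), Finset.card_insert_of_notMem hbB]
  have hzt : z ≠ t := by
    rintro rfl
    refine hg.2 (B.erase z) (by grind) (Finset.card_pos.1 ?_) (by grind) z (by grind)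
    rw [Finset.card_erase_of_mem hz]; omega
  obtain ⟨H, hH⟩ : ∃ H, H = B.erase z := ⟨_, rfl⟩
  have hHm : ∀ v, v ∈ H ↔ v ≠ z ∧ v ∈ B := by simp [hH]
  have hcardH : H.card + 1 = B.card := by
    rw [hH, Finset.card_erase_of_mem hz]; omega
  have htH : t ∈ H := (hHm t).2 ⟨hzt.symm, ht⟩
  -- The path `x, b, z` is split off, so only the case where `H` is not linked is hard.
  have good : ∀ {p q}, G.Linked H p q → G.HasLambdaPartition S := by
    intro p q h
    refine hasLambdaPartition_of_two ih hS (((linked_singleton z).cons (a := b) (by grind) hbz).cons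
      (a := x) (by grind) hxb) h (by grind) (by grind) ?_
    rw [Finset.card_insert_of_notMem (by grind), Finset.card_insert_of_notMem (by grind),
      Finset.card_singleton]
  have hHt : ∀ X ⊆ H, X.Nonempty → (∀ a ∈ X, ∀ b ∈ H, G.Adj a b → b ∈ X) → t ∈ X := by
    intro X hX hX0 hcl
    by_contra htX
    exact hg.2 X (by grind) hX0 (by grind) z (by grind)
  have hHc : G.CutConnected H := by
    intro X hX hX0 hcl
    by_contra hne
    have h1 := hHt X hX hX0 hcl
    have h2 := hHt (H \ X) (by grind) (by
      rw [Finset.nonempty_iff_ne_empty, Ne, Finset.sdiff_eq_empty_iff_subset]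
      exact fun h => hne (hX.antisymm h)) (fun a ha b hb hab => by
        have := hcl b
        have := hab.symm
        grind)
    grind
  -- The neighbours of `z` are sorted by adjacency to `b`. Both classes are cliques: the first by
  -- `hcl`, the second by claw-freeness at `z`. One vertex of each, with `t`, therefore suffices to
  -- guard `H`.
  have hgH : G.Guarded H (({t} ∪ {a | a ∈ H ∧ G.Adj z a ∧ G.Adj b a}) ∪
      {a | a ∈ H ∧ G.Adj z a ∧ ¬ G.Adj b a}) := by
    refine ⟨hHc, fun X hX hX0 hav v hv => hg.2 X (by grind) hX0 ?_ v ?_⟩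
    · rintro a ha (rfl | hat)
      · grind
      · exact hav a ha (Or.inl (Or.inl hat))
    · intro a ha b' hb' hab
      by_cases hbz : b' = z
      · subst hbz
        refine absurd ?_ (hav a ha)
        by_cases hba : G.Adj b a
        · exact Or.inl (Or.inr ⟨hX ha, hab.symm, hba⟩)
        · exact Or.inr ⟨hX ha, hab.symm, hba⟩
      · exact hv a ha b' ((hHm b').2 ⟨hbz, hb'⟩) hab
  have hK : G.IsClique {a | a ∈ H ∧ G.Adj z a ∧ G.Adj b a} := by
    rintro a ⟨ha, -, hba⟩ a' ⟨ha', -, hba'⟩ hne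
    exact hcl ⟨((hHm a).1 ha).2, hba⟩ ⟨((hHm a').1 ha').2, hba'⟩ hne
  have hW : G.IsClique {a | a ∈ H ∧ G.Adj z a ∧ ¬ G.Adj b a} := by
    rintro a ⟨ha, hza, hba⟩ a' ⟨ha', hza', hba'⟩ hne
    rcases hG z a a' b hza hza' hbz.symm hne (by grind) (by grind) with h | h | h
    · exact h
    · exact absurd h.symm hba
    · exact absurd h.symm hba'
  have hznb : ∃ a ∈ H, G.Adj z a := by
    by_contra! hne
    have := hg.1 {z} (by simpa using hz) (by simp) (by grind [SimpleGraph.irrefl])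
    grind
  by_cases hK0 : ∃ a ∈ H, G.Adj z a ∧ G.Adj b a
  swap
  · push Not at hK0
    have hg' : G.Guarded H ({t} ∪ {a | a ∈ H ∧ G.Adj z a ∧ ¬ G.Adj b a}) := by
      refine hgH.of_inter ?_
      rintro a ha ((h | h) | h)
      · exact Or.inl h
      · exact absurd h.2.2 (hK0 a ha h.2.1)
      · exact Or.inr h
    obtain ⟨a, ha, hza⟩ := hznb
    obtain ⟨k, -, hk, hk'⟩ := hg'.exists_of_clique hW ⟨a, ⟨ha, hza, hK0 a ha hza⟩, ha⟩ ⟨t, rfl, htH⟩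
    exact good ⟨hk, htH, hk'⟩
  by_cases hW0 : ∃ a ∈ H, G.Adj z a ∧ ¬ G.Adj b a
  swap
  · push Not at hW0
    have hg' : G.Guarded H ({t} ∪ {a | a ∈ H ∧ G.Adj z a ∧ G.Adj b a}) := by
      refine hgH.of_inter ?_
      rintro a ha (h | h)
      · exact h
      · exact absurd (hW0 a ha h.2.1) h.2.2
    obtain ⟨a, ha, hza⟩ := hznb
    obtain ⟨k, -, hk, hk'⟩ := hg'.exists_of_clique hK ⟨a, ⟨ha, hza, hW0 a ha hza⟩, ha⟩ ⟨t, rfl, htH⟩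
    exact good ⟨hk, htH, hk'⟩
  obtain ⟨a, ha, hza, hba⟩ := hK0
  obtain ⟨a', ha', hza', hba'⟩ := hW0
  obtain ⟨w, ⟨-, hzw, hbw⟩, hw, hgw⟩ :=
    hgH.exists_of_clique hW ⟨a', ⟨ha', hza', hba'⟩, ha'⟩ ⟨t, by simp, htH⟩
  rw [← Set.insert_union] at hgw
  obtain ⟨y, ⟨-, hzy, hby⟩, hy, hgy⟩ :=
    hgw.exists_of_clique hK ⟨a, ⟨ha, hza, hba⟩, ha⟩ ⟨t, by simp, htH⟩
  by_cases hwt : w = t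
  · refine good (p := y) (q := t) ⟨hy, htH, ?_⟩
    rwa [hwt, Set.pair_eq_singleton] at hgy
  by_cases hbad : G.Guarded H {w, t}
  · exact good ⟨hw, htH, hbad⟩
  let bad : Finset V → Prop := fun X => X.Nonempty ∧ w ∉ X ∧ t ∉ X ∧
    ∃ v, ∀ a ∈ X, ∀ b ∈ H, G.Adj a b → b ∈ X ∨ b = v
  have hex : (H.powerset.filter bad).Nonempty := by
    simp only [Guarded, hHc, true_and] at hbad
    push Not at hbad
    obtain ⟨X, hX, hX0, hav, v, hv⟩ := hbad
    exact ⟨X, Finset.mem_filter.2 ⟨Finset.mem_powerset.2 hX, hX0, fun h => hav w h (by simp),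
      fun h => hav t h (by simp), v, hv⟩⟩
  -- A largest obstruction to guarding by `w` and `t` alone: it must contain `y`, and maximality
  -- makes its complement in `H` linked from `w` to `t`.
  obtain ⟨A, hAb, hmax⟩ := Finset.exists_max_image _ Finset.card hex
  obtain ⟨hAH, hA0, hwA, htA, c, hc⟩ := Finset.mem_filter.1 hAb
  rw [Finset.mem_powerset] at hAH
  have hyA : y ∈ A := by
    by_contra hyA
    refine hgy.2 A hAH hA0 ?_ c hc
    rintro a ha (rfl | rfl | rfl) <;> contradiction
  have hcm : c ∈ H ∧ c ∉ A := by
    by_contra hcm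
    have := hHc A hAH hA0 (by grind)
    grind
  obtain ⟨hcH, hcA⟩ := hcm
  obtain ⟨M, hM⟩ : ∃ M, M = H \ A := ⟨_, rfl⟩
  have hMm : ∀ v, v ∈ M ↔ v ∈ H ∧ v ∉ A := by simp [hM]
  have hcardM : A.card + M.card = H.card := by
    rw [hM, Finset.card_sdiff_of_subset hAH]
    have := Finset.card_le_card hAH
    omega
  have hcM : c ∈ M := (hMm c).2 ⟨hcH, hcA⟩
  have hMl : G.Linked M w t := by
    refine ⟨by grind, by grind, ?_, ?_⟩
    · have key : ∀ X ⊆ M, X.Nonempty → (∀ a ∈ X, ∀ b ∈ M, G.Adj a b → b ∈ X) → c ∈ X := by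
        intro X hX hX0 hcl
        by_contra hcX
        have := hHc X (by grind) hX0 (fun a ha b hb hab => by
          have := hc b
          have := hab.symm
          grind)
        grind
      intro X hX hX0 hcl
      by_contra hne
      have h1 := key X hX hX0 hcl
      have h2 := key (M \ X) (by grind) (by
        rw [Finset.nonempty_iff_ne_empty, Ne, Finset.sdiff_eq_empty_iff_subset]
        exact fun h => hne (hX.antisymm h)) (fun a ha b hb hab => by
          have := hcl b
          have := hab.symm
          grind)
      grind
    · intro X hX hX0 hav v hv
      have hwX : w ∉ X := fun h => hav w h (by simp)
      have htX : t ∉ X := fun h => hav t h (by simp)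
      by_cases hcX : c ∈ X
      · have h1 := hmax (X ∪ A) (Finset.mem_filter.2 ⟨Finset.mem_powerset.2 (by grind),
          ⟨c, by grind⟩, by grind, by grind, v, by grind⟩)
        have h2 : A.card < (X ∪ A).card := Finset.card_lt_card
          ⟨Finset.subset_union_right, fun h => hcA (h (Finset.mem_union_left _ hcX))⟩
        omega
      · refine hgy.2 X (by grind) hX0 ?_ v (fun a ha b hb hab => ?_)
        · rintro a ha (rfl | h)
          · grind
          · exact hav a ha h
        · have h1 := hc b
          have h2 := hab.symm
          grind
  have hcnb : ∃ e ∈ M.erase c, G.Adj c e := by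
    by_contra! hne
    have := hMl.2.2.1 {c} (by simpa using hcM) (by simp) (by grind [SimpleGraph.irrefl])
    have h1 := hMl.1
    have h2 := hMl.2.1
    rw [← this] at h1 h2
    grind
  obtain ⟨e, he, hce⟩ := hcnb
  have hAM : ∀ a ∈ A, ∀ b ∈ M.erase c, ¬ G.Adj a b := by
    intro a ha b hb hab
    have := hc a ha b
    grind
  have hclA := hG.isClique (A := A) he hce (by grind) hAM
  obtain ⟨k, hkA, hck, hAl⟩ := exists_linked_of_side hgy hAH hyA (by grind) hcH hcA hc hclA
  obtain ⟨p, q, hpq⟩ := hMl.exists_erase hwt hcM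
    (hG.isClique (A := M.erase c) hkA hck (by grind) (fun a ha b hb hab => hAM b hb a ha hab.symm))
  refine hasLambdaPartition_of_tail_and_two ih hS ?_ hxb hbz hzy hzw hby hck hAl hMl hpq hcM
    (by omega) (by grind) (by grind) (by grind) (by grind) (by grind) (by grind) (by grind)
  intro v
  rw [hm, hMm, hHm]
  have h1 := hHm v
  have h2 := @hAH v
  by_cases hvz : v = z
  · simp [hvz, hz]
  · tauto

/-! ### The induction -/

/-- The sides have total size 2 mod 3, so giving `c` to one of them works unless both have residue
1. -/
lemma IsSplit.hasLambdaPartition_or (h : G.IsSplit S c A B) (hG : G.LocallyTwo)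
    (ih : ∀ T p q, T.card < S.card → 3 ∣ T.card → G.Linked T p q → G.HasLambdaPartition T)
    (hS : 3 ∣ S.card) (hl : G.Linked S s t) (hs : s ∈ A) (ht : t ∈ B) :
    G.HasLambdaPartition S ∨ A.card % 3 = 1 := by
  classical
  obtain ⟨k, -, hk, hkl⟩ := h.exists_linked_left hG hl hs
  obtain ⟨l, -, hl1, hll⟩ := h.symm.exists_linked_left hG hl.symm ht
  have hcard := h.card_eq
  have hm := h.mem_iff
  have hcA := h.notMem_left
  have hcB := h.notMem_right
  have hd := h.disj
  obtain h0 | h0 | h0 : A.card % 3 = 0 ∨ A.card % 3 = 1 ∨ A.card % 3 = 2 := by omega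
  · exact .inl (hasLambdaPartition_of_two ih hS hkl (hll.snoc hcB hl1.symm) (by grind) (by grind)
      (by omega))
  · exact .inr h0
  · refine .inl (hasLambdaPartition_of_two ih hS (hkl.snoc hcA hk.symm) hll (by grind) (by grind) ?_)
    rw [Finset.card_insert_of_notMem hcA]
    omega

lemma IsSplit.hasLambdaPartition (h : G.IsSplit S c A B) (hG : G.LocallyTwo)
    (ih : ∀ T p q, T.card < S.card → 3 ∣ T.card → G.Linked T p q → G.HasLambdaPartition T)
    (hS : 3 ∣ S.card) (hl : G.Linked S s t) (hs : s ∈ A) (ht : t ∈ B)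
    (hmin : ∀ c' A' B', G.IsSplit S c' A' B' → A.card ≤ A'.card) : G.HasLambdaPartition S := by
  classical
  rcases h.hasLambdaPartition_or hG ih hS hl hs ht with h0 | hmod
  · exact h0
  obtain ⟨k, hkA, hck, hkl⟩ := h.exists_linked_left hG hl hs
  obtain ⟨l, hlB, hcl, hll⟩ := h.symm.exists_linked_left hG hl.symm ht
  have hcard := h.card_eq
  have hm := h.mem_iff
  have hcA := h.notMem_left
  have hcB := h.notMem_right
  have hd := h.disj
  have hAB := h.not_adj
  by_cases h1 : A.card = 1
  · obtain ⟨a, rfl⟩ := Finset.card_eq_one.1 h1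
    rw [Finset.mem_singleton] at hs hkA
    subst hkA
    by_cases hB1 : B.card = 1
    · exact hl.2.2.1.hasLambdaPartition (by omega)
    · exact hasLambdaPartition_of_pendant hG ih hS (x := k) (b := c) (B := B) (by grind) hck.symm
        (by grind) hcB hcl hll.symm (hG.isClique (A := B) (Finset.mem_singleton_self k) hck
          (by grind) (fun a ha b hb hab => hAB b hb a ha hab.symm)) (by
            have := h.nonempty_right.card_pos
            omega)
  · have hclA := hG.isClique hlB hcl hd hAB
    -- Each side of a split of `A` contains a neighbour of `c`, or it would be a smaller side of
    -- `S`. These neighbours are adjacent, which the split forbids. So `k` can move from `A` to the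
    -- other piece.
    have hn : G.NoCut A := by
      have key : ∀ c' A' B', G.IsSplit A c' A' B' → ∃ a ∈ A', G.Adj c a := by
        intro c' A' B' h'
        by_contra! hne
        have hm' := h'.mem_iff
        have hadj' := h'.not_adj
        have h5 := h'.card_eq
        have h6 := hmin c' A' (S \ insert c' A') ⟨by grind, h'.notMem_left, by simp, by grind,
          h'.nonempty_left, ⟨c, by grind⟩, ?_⟩
        · omega
        · intro a ha b hb hab
          have h7 := hAB a (by grind) b
          have h8 := hadj' a ha b
          have h9 := hne a ha
          have h10 := hab.symm
          grind
      intro c' A' B' h'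
      obtain ⟨a, ha, hca⟩ := key c' A' B' h'
      obtain ⟨b, hb, hcb⟩ := key c' B' A' h'.symm
      have hm' := h'.mem_iff
      have hab : a ≠ b := fun hab => h'.disj a ha (hab ▸ hb)
      exact h'.not_adj a ha b hb (hclA ⟨by grind, hca⟩ ⟨by grind, hcb⟩ hab)
    obtain ⟨p, q, -, -, hpq⟩ := hn.exists_linked_erase hkl.2.2.1 hG hkA (by omega)
    refine hasLambdaPartition_of_two ih hS hpq ((hll.snoc hcB hcl.symm).snoc (a := k)
      (by grind) hck) (by grind) (by grind) ?_
    rw [Finset.card_erase_of_mem hkA]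
    omega

/-- In a claw-free graph, a linked vertex set of size divisible by three can be partitioned into
3-vertex paths. -/
theorem Linked.hasLambdaPartition (hG : G.LocallyTwo) (hl : G.Linked S s t) (hS : 3 ∣ S.card) :
    G.HasLambdaPartition S := by
  classical
  induction hn : S.card using Nat.strong_induction_on generalizing S s t with
  | _ n ih =>
    subst hn
    have ih' : ∀ T p q, T.card < S.card → 3 ∣ T.card → G.Linked T p q →
        G.HasLambdaPartition T := fun T p q h1 h2 h3 => ih T.card h1 h3 h2 rfl
    by_cases hcut : G.NoCut S
    · exact hcut.hasLambdaPartition hl.2.2.1 hG ih' hS ⟨s, hl.1⟩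
    · simp only [NoCut, not_forall, not_not] at hcut
      have hex : ∃ n c A B, G.IsSplit S c A B ∧ A.card = n := by
        obtain ⟨c, A, B, h⟩ := hcut
        exact ⟨_, c, A, B, h, rfl⟩
      obtain ⟨c, A, B, h, hA⟩ := Nat.find_spec hex
      have hmin : ∀ c' A' B', G.IsSplit S c' A' B' → A.card ≤ A'.card := fun c' A' B' h' =>
        hA ▸ Nat.find_min' hex ⟨c', A', B', h', rfl⟩
      rcases h.terminals hl with ⟨h1, h2⟩ | ⟨h1, h2⟩
      · exact h.hasLambdaPartition hG ih' hS hl h1 h2 hmin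
      · exact h.hasLambdaPartition hG ih' hS hl.symm h1 h2 hmin

/-! ### From partitions to factors -/

/-- The edges of a partition into 3-vertex paths form a graph all of whose neighbourhoods inside
the partitioned set are those of a 3-vertex path. -/
lemma HasLambdaPartition.exists_graph (h : G.HasLambdaPartition S) :
    ∃ M : SimpleGraph V, M ≤ G ∧ (∀ a b, M.Adj a b → a ∈ S) ∧
      ∀ u ∈ S, ∃ a b c, a ∈ S ∧ b ∈ S ∧ c ∈ S ∧ a ≠ c ∧ (u = a ∨ u = b ∨ u = c) ∧
        (∀ w, M.Adj a w ↔ w = b) ∧ (∀ w, M.Adj b w ↔ w = a ∨ w = c) ∧ ∀ w, M.Adj c w ↔ w = b := by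
  induction h with
  | empty => exact ⟨⊥, bot_le, by simp, by simp⟩
  | @step S T a b c hS hab hbc hac ha hb hc hT ih =>
    obtain ⟨M, hM, hMS, hMu⟩ := ih
    have hab' := hab.ne
    have hbc' := hbc.ne
    have hMS' : ∀ a b, M.Adj a b → b ∈ S := fun a b h => hMS b a h.symm
    have hadj : ∀ u w, (M ⊔ edge a b ⊔ edge b c).Adj u w ↔ M.Adj u w ∨ (u = a ∧ w = b) ∨
        (u = b ∧ w = a) ∨ (u = b ∧ w = c) ∨ (u = c ∧ w = b) := by
      intro u w
      simp only [sup_adj, edge_adj]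
      grind
    refine ⟨M ⊔ edge a b ⊔ edge b c, ?_, ?_, ?_⟩
    · intro u w h
      have h1 := hab.symm
      have h2 := hbc.symm
      rcases (hadj u w).1 h with h | ⟨rfl, rfl⟩ | ⟨rfl, rfl⟩ | ⟨rfl, rfl⟩ | ⟨rfl, rfl⟩
      · exact hM h
      all_goals assumption
    · intro u w h
      have := hMS u w
      have := (hadj u w).1 h
      grind
    · intro u hu
      by_cases huS : u ∈ S
      · obtain ⟨a', b', c', h1, h2, h3, h4, h5, h6, h7, h8⟩ := hMu u huS
        refine ⟨a', b', c', by grind, by grind, by grind, h4, h5, ?_, ?_, ?_⟩ <;> intro w <;>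
          rw [hadj] <;> grind
      · refine ⟨a, b, c, by grind, by grind, by grind, hac, by grind, ?_, ?_, ?_⟩ <;> intro w <;>
          rw [hadj]
        · have := hMS a w
          grind
        · have := hMS b w
          grind
        · have := hMS c w
          grind

/-- A component containing vertices `a, b, c` with the neighbourhoods of a 3-vertex path is one. -/
lemma nonempty_iso_pathGraph_three {U : Type*} {M : SimpleGraph U} (C : M.ConnectedComponent)
    {a b c : U} (haC : a ∈ C.supp) (hac : a ≠ c) (ha : ∀ w, M.Adj a w ↔ w = b)
    (hb : ∀ w, M.Adj b w ↔ w = a ∨ w = c) (hc : ∀ w, M.Adj c w ↔ w = b) :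
    Nonempty (C.toSimpleGraph ≃g pathGraph 3) := by
  have hab : M.Adj a b := (ha b).2 rfl
  have hcb : M.Adj c b := (hc b).2 rfl
  have hbC : b ∈ C.supp := C.mem_supp_of_adj_mem_supp haC hab
  have hcC : c ∈ C.supp := C.mem_supp_of_adj_mem_supp hbC hcb.symm
  have hcl : ∀ u v, M.Walk u v → (u = a ∨ u = b ∨ u = c) → (v = a ∨ v = b ∨ v = c) := by
    intro u v p
    induction p with
    | nil => exact id
    | @cons u v w h p ih =>
      intro hu
      apply ih
      rcases hu with rfl | rfl | rfl
      · exact .inr (.inl ((ha v).1 h))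
      · rcases (hb v).1 h with h | h
        · exact .inl h
        · exact .inr (.inr h)
      · exact .inr (.inl ((hc v).1 h))
  have hsupp : ∀ v ∈ C.supp, v = a ∨ v = b ∨ v = c := by
    intro v hv
    have : M.Reachable a v := ConnectedComponent.exact (haC.trans hv.symm)
    obtain ⟨p⟩ := this
    exact hcl a v p (.inl rfl)
  let f : Fin 3 → C := ![⟨a, haC⟩, ⟨b, hbC⟩, ⟨c, hcC⟩]
  have hab' := hab.ne
  have hcb' := hcb.ne
  have hf : Function.Bijective f := by
    constructor
    · intro i j hij
      fin_cases i <;> fin_cases j <;> simp_all [f, Subtype.ext_iff]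
    · rintro ⟨v, hv⟩
      rcases hsupp v hv with rfl | rfl | rfl
      · exact ⟨0, rfl⟩
      · exact ⟨1, rfl⟩
      · exact ⟨2, rfl⟩
  refine ⟨(RelIso.symm ⟨Equiv.ofBijective f hf, ?_⟩ : _ ≃g _)⟩
  intro i j
  change M.Adj (f i : U) (f j : U) ↔ _
  fin_cases i <;> fin_cases j <;> simp [f, ha, hb, hc, pathGraph_adj, hab', hcb', hac,
    hac.symm]

lemma HasLambdaPartition.hasLambdaFactor {s : Set V} (h : G.HasLambdaPartition S)
    (hs : ∀ x, x ∈ S ↔ x ∈ s) : (G.induce s).HasLambdaFactor := by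
  obtain ⟨M, hM, -, hMu⟩ := h.exists_graph
  let P : (G.induce s).Subgraph :=
    { verts := Set.univ
      Adj := fun u v => M.Adj u v
      adj_sub := fun h => hM h
      edge_vert := fun _ => Set.mem_univ _
      symm := ⟨fun _ _ h => h.symm⟩ }
  refine ⟨P, fun C => ?_, fun v => Set.mem_univ v⟩
  obtain ⟨⟨⟨u, hu⟩, hu'⟩, huC⟩ := C.nonempty_supp
  obtain ⟨a, b, c, ha, hb, hc, hac, huabc, hMa, hMb, hMc⟩ := hMu u ((hs u).2 hu)
  have hba : M.Adj b a := (hMb a).2 (.inl rfl)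
  have hbc : M.Adj b c := (hMb c).2 (.inr rfl)
  let a' : P.verts := ⟨⟨a, (hs a).1 ha⟩, trivial⟩
  let b' : P.verts := ⟨⟨b, (hs b).1 hb⟩, trivial⟩
  let c' : P.verts := ⟨⟨c, (hs c).1 hc⟩, trivial⟩
  have hba' : P.coe.Adj b' a' := hba
  have hbc' : P.coe.Adj b' c' := hbc
  have haC : a' ∈ C.supp := by
    rcases huabc with rfl | rfl | rfl
    · exact huC
    · exact C.mem_supp_of_adj_mem_supp huC hba'
    · exact C.mem_supp_of_adj_mem_supp (C.mem_supp_of_adj_mem_supp huC hbc'.symm) hba'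
  have hval : ∀ p q : P.verts, p = q ↔ ((p : s) : V) = ((q : s) : V) := fun p q =>
    Subtype.ext_iff.trans Subtype.ext_iff
  refine nonempty_iso_pathGraph_three C (b := b') (c := c') haC ?_ ?_ ?_ ?_
  · exact fun h => hac ((hval _ _).1 h)
  · intro w
    rw [hval]
    exact hMa _
  · intro w
    rw [hval, hval]
    exact hMb _
  · intro w
    rw [hval]
    exact hMc _

/-! ### Use of 4-connectedness -/

lemma exists_adj_of_induce_connected {s : Set V} (h : (G.induce s).Connected) {X : Set V}
    (hX : X ⊆ s) {p q : V} (hp : p ∈ X) (hq : q ∈ s) (hqX : q ∉ X) :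
    ∃ a ∈ X, ∃ b ∈ s, b ∉ X ∧ G.Adj a b := by
  obtain ⟨w⟩ := h.preconnected ⟨p, hX hp⟩ ⟨q, hq⟩
  obtain ⟨d, -, h1, h2⟩ := w.exists_boundary_dart {v | (v : V) ∈ X} hp hqX
  exact ⟨d.fst, h1, d.snd, d.snd.2, h2, d.adj⟩

lemma Subgraph.IsThreeVertexPath.encard_verts {L : G.Subgraph} (hL : L.IsThreeVertexPath) :
    L.verts.encard = 3 := by
  obtain ⟨e⟩ := hL
  rw [Set.encard, ENat.card_congr e.toEquiv]
  simp

end SimpleGraph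

open SimpleGraph

theorem mainTheorem5 {V : Type*} [Finite V] (G : SimpleGraph V)
    (hconn : G.IsKConnected 4) (hclaw : G.IsClawFree)
    (L : G.Subgraph) (hL : L.IsThreeVertexPath) :
    (G.induce L.vertsᶜ).Connected ∧
      (3 ∣ Nat.card V → (G.induce L.vertsᶜ).HasLambdaFactor) := by
  classical
  have hL3 := hL.encard_verts
  have hcon : (G.induce L.vertsᶜ).Connected := hconn.2 _ (by rw [hL3]; norm_num)
  refine ⟨hcon, fun hdvd => ?_⟩
  have := Fintype.ofFinite V
  let H : Finset V := Finset.univ.filter (· ∉ L.verts)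
  have hH : ∀ v, v ∈ H ↔ v ∈ L.vertsᶜ := by simp [H]
  have hLn : L.verts.ncard = 3 := by rw [Set.ncard, hL3]; rfl
  have hcardH : H.card + 3 = Nat.card V := by
    have h1 : H.card = L.vertsᶜ.ncard := by
      rw [← Set.ncard_coe_finset]; congr 1; ext; simp [H]
    rw [h1, ← hLn, add_comm, Set.ncard_add_ncard_compl]
  have hcard4 : 4 < Nat.card V := by
    have := hconn.1
    rw [ENat.card_eq_coe_natCard] at this
    exact_mod_cast this
  obtain ⟨x, hx⟩ : L.verts.Nonempty := by
    rw [← Set.encard_ne_zero, hL3]; norm_num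
  have hHc : G.CutConnected H := by
    intro X hX ⟨p, hp⟩ hcl
    by_contra hne
    obtain ⟨q, hq, hqX⟩ : ∃ q ∈ H, q ∉ X := by
      by_contra! h
      exact hne (hX.antisymm h)
    obtain ⟨a, ha, b, hb, hbX, hab⟩ := exists_adj_of_induce_connected hcon (X := (X : Set V))
      (fun v hv => (hH v).1 (hX hv)) hp ((hH q).1 hq) hqX
    exact hbX (hcl a ha b ((hH b).2 hb) hab)
  have hg : G.Guarded H {y | G.Adj x y} := by
    refine ⟨hHc, fun X hX ⟨p, hp⟩ hav v hv => ?_⟩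
    by_cases hvH : v ∈ H ∧ v ∉ X
    swap
    · have := hHc X hX ⟨p, hp⟩ (by grind)
      subst this
      obtain ⟨a, ha, b, hb, hbX, hab⟩ := exists_adj_of_induce_connected
        (hconn.2 (L.verts \ {x}) (lt_of_le_of_lt (Set.encard_le_encard Set.sdiff_subset)
          (by rw [hL3]; norm_num))) (X := (H : Set V)) (p := p) (q := x)
        (fun v hv h => (hH v).1 hv h.1) hp (by simp) (fun h => (hH x).1 h hx)
      have hbL : b ∈ L.verts := by
        by_contra h
        exact hbX ((hH b).2 h)
      have hbx : b = x := by
        by_contra h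
        exact hb ⟨hbL, h⟩
      exact hav a ha (hbx ▸ hab.symm)
    · obtain ⟨hvH, hvX⟩ := hvH
      -- Keeping `x` leaves room to delete `v` as well. An edge leaving `X` after this deletion ends
      -- at `x` or at a second outer neighbour in `H`, and both are excluded.
      have hSc : (insert v (L.verts \ {x})).encard < (4 : ℕ) := by
        have h1 := Set.encard_sdiff_singleton_add_one hx
        rw [hL3] at h1
        have h2 := Set.encard_insert_le (L.verts \ {x}) v
        rw [h1] at h2
        exact lt_of_le_of_lt h2 (by norm_num)
      have hvx : v ≠ x := fun h => (hH v).1 hvH (h ▸ hx)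
      obtain ⟨a, ha, b, hb, hbX, hab⟩ := exists_adj_of_induce_connected
        (hconn.2 _ hSc) (X := (X : Set V)) (p := p) (q := x)
        (fun u hu h => by
          rcases h with rfl | h
          · exact hvX hu
          · exact (hH u).1 (hX hu) h.1) hp (by simp [Ne.symm hvx])
        (fun h => (hH x).1 (hX h) hx)
      simp only [Set.mem_compl_iff, Set.mem_insert_iff, not_or] at hb
      by_cases hbx : b = x
      · exact hav a ha (hbx ▸ hab.symm)
      · have hbH : b ∈ H := (hH b).2 fun h => hb.2 ⟨h, hbx⟩
        rcases hv a ha b hbH hab with h | h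
        · exact hbX h
        · exact hb.1 h
  have hG := hclaw.locallyTwo
  obtain ⟨y, w, -, -, hyw⟩ := exists_linked_of_guarded_neighbors hG hg (by omega)
  exact (hyw.hasLambdaPartition hG (by omega)).hasLambdaFactor hH
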